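/- A \emph{generalised hexagon} is a nonempty point-line geometry $\Gamma=(\mathcal P,\mathcal L)$ containing no ordinary $2$-, $3$-, $4$- or $5$-gon as a subgeometry and such that any two elements of $\mathcal P\cup\mathcal L$ are contained in an ordinary hexagon; it is \emph{thick} if every line contains at least $3$ points and every point is on at least $3$ lines. Let $d$ be the distance in the incidence graph, write $\Gamma_i(x)$ for the set of elements at distance $i$ from $x$, and call $x,y$ \emph{opposite} if $d(x,y)=6$. A \emph{Moufang hexagon} is a thick generalised hexagon such that for every path $(x_0,x_1,\dots,x_6)$ in the incidence graph with $x_{i-1}\neq x_{i+1}$ for $1\le i\le 5$, the group of collineations fixing every element incident with at least one of $x_1,\dots,x_5$ acts transitively on $\Gamma_1(x_6)\setminus\{x_5\}$. A point $x$ is \emph{regular} if, for $i=2$ and for $i=3$ and for all $y,y'$ opposite $x$, the sets $\Gamma_i(x)\cap\Gamma_{6-i}(y)$ and $\Gamma_i(x)\cap\Gamma_{6-i}(y')$ are either equal or have at most one element in common. An \emph{ovoid} is a set $O$ of mutually opposite points such that every element of $\mathcal P\cup\mathcal L$ is at distance at most $3$ from some element of $O$. \textbf{Theorem.} Let $\Gamma$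 be a Moufang hexagon all of whose points are regular. Then no nontrivial collineation of $\Gamma$ fixes an ovoid of $\Gamma$ pointwise; that is, if $\theta$ is a collineation of $\Gamma$ and $O$ is an ovoid of $\Gamma$ with $p^\theta=p$ for all $p\in O$, then $\theta$ is the identity. -/

import Mathlib

/-! Point-line geometries are given by a type `P` of points, a type `L` of lines and an incidence
relation `I : P → L → Prop`; the elements of the geometry are the members of `P ⊕ L`. -/

namespace MoufangHexagon

universe u v

variable {P : Type u} {L : Type v}

/-- An ordinary `n`-gon in the geometry: `n` distinct points and `n` distinct lines, cyclically
indexed, such that the `i`-th line is incident with the `i`-th and the `(i+1)`-st point. -/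
structure OrdinaryPolygon (I : P → L → Prop) (n : ℕ) where
  pt : ZMod n → P
  ln : ZMod n → L
  pt_injective : Function.Injective pt
  ln_injective : Function.Injective ln
  inc_left : ∀ i, I (pt i) (ln i)
  inc_right : ∀ i, I (pt (i + 1)) (ln i)

/-- The set of elements (points and lines) of an ordinary `n`-gon. -/
def OrdinaryPolygon.elements {I : P → L → Prop} {n : ℕ} (A : OrdinaryPolygon I n) : Set (P ⊕ L) :=
  Set.range (fun i => Sum.inl (A.pt i)) ∪ Set.range (fun i => Sum.inr (A.ln i))

/-- A generalised hexagon: a nonempty geometry without ordinary `2`-, `3`-, `4`- or `5`-gons in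
which any two elements lie in an ordinary hexagon. -/
structure IsGeneralisedHexagon (I : P → L → Prop) : Prop where
  nonempty : Nonempty (P ⊕ L)
  no_small_polygon : ∀ n : ℕ, 2 ≤ n → n ≤ 5 → IsEmpty (OrdinaryPolygon I n)
  exists_hexagon : ∀ x y : P ⊕ L, ∃ A : OrdinaryPolygon I 6, x ∈ A.elements ∧ y ∈ A.elements

/-- Every line has at least three points, and every point is on at least three lines. -/
def IsThick (I : P → L → Prop) : Prop :=
  (∀ l : L, 3 ≤ {p : P | I p l}.encard) ∧ (∀ p : P, 3 ≤ {l : L | I p l}.encard)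

/-- The incidence graph. -/
def incidenceGraph (I : P → L → Prop) : SimpleGraph (P ⊕ L) where
  Adj
    | Sum.inl p, Sum.inr l => I p l
    | Sum.inr l, Sum.inl p => I p l
    | _, _ => False
  symm := ⟨by rintro (p | l) (q | m) h <;> exact h⟩
  loopless := ⟨by rintro (p | l) h <;> exact h⟩

/-- Distance of two elements in the incidence graph. (The incidence graph of a generalised hexagon
is connected, so this is the true graph distance there.) -/
noncomputable def eltDist (I : P → L → Prop) (x y : P ⊕ L) : ℕ :=
  (incidenceGraph I).dist x y

/-- Two elements are opposite if they are at distance `6`. -/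
def Opposite (I : P → L → Prop) (x y : P ⊕ L) : Prop :=
  eltDist I x y = 6

/-- Collineations: incidence-preserving permutations of the points and of the lines. -/
@[ext]
structure Collineation (I : P → L → Prop) where
  onPoints : P ≃ P
  onLines : L ≃ L
  map_inc : ∀ p l, I (onPoints p) (onLines l) ↔ I p l

/-- The trivial collineation. -/
def Collineation.refl (I : P → L → Prop) : Collineation I where
  onPoints := Equiv.refl P
  onLines := Equiv.refl L
  map_inc := fun _ _ => Iff.rfl

/-- The action of a collineation on the elements. -/
def Collineation.onElements {I : P → L → Prop} (θ : Collineation I) : P ⊕ L → P ⊕ L :=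
  Sum.map θ.onPoints θ.onLines

/-- A root: a non-stammering path `x₀, …, x₆` of length six in the incidence graph. -/
structure IsRoot (I : P → L → Prop) (x : Fin 7 → P ⊕ L) : Prop where
  adj : ∀ i : Fin 6, (incidenceGraph I).Adj (x i.castSucc) (x i.succ)
  ne : ∀ i : Fin 5, x i.castSucc.castSucc ≠ x i.succ.succ

/-- A root elation for `x₀, …, x₆`: a collineation fixing every element incident with at least one
of the interior elements `x₁, …, x₅` (so in particular all of `x₀, …, x₆`). -/
def IsRootElation (I : P → L → Prop) (x : Fin 7 → P ⊕ L) (g : Collineation I) : Prop :=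
  ∀ i : Fin 7, i ≠ 0 → i ≠ 6 → ∀ z : P ⊕ L, (incidenceGraph I).Adj (x i) z → g.onElements z = z

/-- A Moufang hexagon: a thick generalised hexagon such that, for every root `x₀, …, x₆`, the root
elations act transitively on the elements incident with `x₆` and different from `x₅`. -/
structure IsMoufangHexagon (I : P → L → Prop) : Prop where
  isGeneralisedHexagon : IsGeneralisedHexagon I
  isThick : IsThick I
  moufang : ∀ x : Fin 7 → P ⊕ L, IsRoot I x → ∀ y y' : P ⊕ L,
    (incidenceGraph I).Adj (x 6) y → y ≠ x 5 → (incidenceGraph I).Adj (x 6) y' → y' ≠ x 5 →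
      ∃ g : Collineation I, IsRootElation I x g ∧ g.onElements y = y'

/-- The distance-`i`-trace `Γᵢ(x) ∩ Γ₆₋ᵢ(y)`. -/
def trace (I : P → L → Prop) (i : ℕ) (x y : P ⊕ L) : Set (P ⊕ L) :=
  {z | eltDist I x z = i ∧ eltDist I y z = 6 - i}

/-- Distinct distance-`i`-traces of `x` have at most one element in common. -/
def IsDistanceRegular (I : P → L → Prop) (i : ℕ) (x : P ⊕ L) : Prop :=
  ∀ y y' : P ⊕ L, Opposite I x y → Opposite I x y' → trace I i x y ≠ trace I i x y' →
    (trace I i x y ∩ trace I i x y').Subsingleton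

/-- An element is regular if it is distance-`2`-regular and distance-`3`-regular. -/
def IsRegular (I : P → L → Prop) (x : P ⊕ L) : Prop :=
  IsDistanceRegular I 2 x ∧ IsDistanceRegular I 3 x

/-- All points are regular. -/
def IsPointRegular (I : P → L → Prop) : Prop :=
  ∀ p : P, IsRegular I (Sum.inl p)

/-- An ovoid: a set of mutually opposite points such that every element is at distance at most `3`
from some member of the set. -/
structure IsOvoid (I : P → L → Prop) (O : Set P) : Prop where
  opposite : ∀ p ∈ O, ∀ q ∈ O, p ≠ q → Opposite I (Sum.inl p) (Sum.inl q)
  cover : ∀ x : P ⊕ L, ∃ p ∈ O, eltDist I x (Sum.inl p) ≤ 3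

/-- A collineation fixes a set of points if it fixes each of its members. -/
def Collineation.Fixes {I : P → L → Prop} (θ : Collineation I) (O : Set P) : Prop :=
  ∀ p ∈ O, θ.onPoints p = p

end MoufangHexagon

/-! The points of the ovoid `O` pin down every other point. Let `y ∈ O` and let `z` be a point
collinear with `y`. There are `x, w ∈ O` for which `trace I 2 y x` and `trace I 2 y w` are distinct
and both contain `z`. As `y` is distance-`2`-regular they meet in `z` only, so a collineation fixing
`x`, `y` and `w` fixes `z`. Every point is in `O` or collinear with a point of `O`.

Take `x ∈ O` at distance `4` from `z`. A line through `z` leading neither to `x` nor to `y` carries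
a point `k` opposite `x` with `trace I 2 x k = trace I 2 x y`: by regularity of `x` it is enough
that the two traces share two points. Let `w ∈ O` be collinear with `k`, on the line `W`, and let
`k₀` be the point of `W` nearest `x`. If `trace I 2 y x = trace I 2 y w`, the two equalities of
traces, transported along the geodesics from `k₀` to `x` and to `y`, show that `k₀` is also the
point of `W` nearest `y`. But that point is `k`, which is opposite `x`. -/

namespace MoufangHexagon

section Graph

variable {V W : Type*} {G : SimpleGraph V} {H : SimpleGraph W} {x y m m' : V}

theorem dist_iso (f : G ≃g H) (x y : V) : H.dist (f x) (f y) = G.dist x y := by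
  refine SimpleGraph.dist_eq_sInf.trans (Eq.trans ?_ SimpleGraph.dist_eq_sInf.symm)
  congr 1
  ext k
  constructor
  · rintro ⟨w, rfl⟩
    exact ⟨(w.map f.symm.toHom).copy (f.symm_apply_apply x) (f.symm_apply_apply y), by simp⟩
  · rintro ⟨w, rfl⟩
    exact ⟨w.map f.toHom, by simp⟩

theorem exists_dist_eq_of_dist_eq_add (hG : G.Connected) {j k : ℕ} (hxy : G.dist x y = j + k) :
    ∃ m, G.dist x m = j ∧ G.dist y m = k := by
  obtain ⟨w, hw⟩ := hG.exists_walk_length_eq_dist x y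
  have htake := SimpleGraph.dist_le (w.take j)
  have hdrop := SimpleGraph.dist_le (w.drop j)
  have htriangle := hG.dist_triangle (u := x) (v := w.getVert j) (w := y)
  rw [SimpleGraph.Walk.take_length] at htake
  rw [SimpleGraph.Walk.drop_length] at hdrop
  exact ⟨w.getVert j, by omega, by rw [SimpleGraph.dist_comm]; omega⟩

theorem path_eq_of_add_length_lt_egirth {p q : G.Walk x y} (hp : p.IsPath) (hq : q.IsPath)
    (h : ((p.length + q.length : ℕ) : ℕ∞) < G.egirth) : p = q := by
  by_contra hne
  obtain ⟨_, _, _, c, hc, hlen⟩ := hp.exists_isCycle_length_le_add_of_ne hq hne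
  exact absurd ((SimpleGraph.egirth_le_length hc).trans (by exact_mod_cast hlen)) h.not_ge

theorem eq_of_dist_eq_of_two_mul_lt_egirth (hG : G.Connected) {j k : ℕ}
    (hxm : G.dist x m = j) (hym : G.dist y m = k) (hxm' : G.dist x m' = j)
    (hym' : G.dist y m' = k) (hxy : G.dist x y = j + k)
    (hlt : ((2 * (j + k) : ℕ) : ℕ∞) < G.egirth) : m = m' := by
  obtain ⟨p, hp⟩ := hG.exists_walk_length_eq_dist x m
  obtain ⟨q, hq⟩ := hG.exists_walk_length_eq_dist m y
  obtain ⟨p', hp'⟩ := hG.exists_walk_length_eq_dist x m'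
  obtain ⟨q', hq'⟩ := hG.exists_walk_length_eq_dist m' y
  have hpq : (p.append q).length = G.dist x y := by
    rw [SimpleGraph.Walk.length_append, hp, hq, hxm, SimpleGraph.dist_comm, hym, hxy]
  have hpq' : (p'.append q').length = G.dist x y := by
    rw [SimpleGraph.Walk.length_append, hp', hq', hxm', SimpleGraph.dist_comm, hym', hxy]
  have hpath : p.append q = p'.append q' :=
    path_eq_of_add_length_lt_egirth ((p.append q).isPath_of_length_eq_dist hpq)
      ((p'.append q').isPath_of_length_eq_dist hpq') (by rwa [hpq, hpq', ← two_mul, hxy])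
  calc m = (p.append q).getVert p.length := by simp [SimpleGraph.Walk.getVert_append]
    _ = (p'.append q').getVert p'.length := by rw [hpath, hp, hp', hxm, hxm']
    _ = m' := by simp [SimpleGraph.Walk.getVert_append]

end Graph

variable {P L : Type*} {I : P → L → Prop}

/-- The bipartition of the incidence graph into points (`true`) and lines (`false`). -/
def incidenceColoring (I : P → L → Prop) : (incidenceGraph I).Coloring Bool :=
  SimpleGraph.Coloring.mk Sum.isLeft <| by rintro (p | l) (q | m) <;> simp [incidenceGraph]

theorem even_length_iff_isLeft_eq {x y : P ⊕ L} (w : (incidenceGraph I).Walk x y) :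
    Even w.length ↔ x.isLeft = y.isLeft :=
  ((incidenceColoring I).even_length_iff_congr w).trans Bool.eq_iff_iff.symm

namespace OrdinaryPolygon

variable {n : ℕ}

/-- The elements of an ordinary `n`-gon in cyclic order, points at even and lines at odd places,
indexed by `ℕ` with period `2 * n`. -/
def vertex (A : OrdinaryPolygon I n) (k : ℕ) : P ⊕ L :=
  if Even k then Sum.inl (A.pt (k / 2 : ℕ)) else Sum.inr (A.ln (k / 2 : ℕ))

theorem vertex_two_mul (A : OrdinaryPolygon I n) (k : ℕ) : A.vertex (2 * k) = Sum.inl (A.pt k) := by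
  simp [vertex]

theorem vertex_two_mul_add_one (A : OrdinaryPolygon I n) (k : ℕ) :
    A.vertex (2 * k + 1) = Sum.inr (A.ln k) := by
  simp [vertex, Nat.mul_add_div]

theorem adj_vertex_succ (A : OrdinaryPolygon I n) (k : ℕ) :
    (incidenceGraph I).Adj (A.vertex k) (A.vertex (k + 1)) := by
  obtain ⟨j, rfl | rfl⟩ := k.even_or_odd'
  · rw [vertex_two_mul, vertex_two_mul_add_one]
    exact A.inc_left j
  · rw [vertex_two_mul_add_one, show 2 * j + 1 + 1 = 2 * (j + 1) by ring, vertex_two_mul,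
      Nat.cast_succ]
    exact A.inc_right j

theorem vertex_add_two_mul (A : OrdinaryPolygon I n) (k : ℕ) :
    A.vertex (k + 2 * n) = A.vertex k := by
  obtain ⟨j, rfl | rfl⟩ := k.even_or_odd'
  · rw [← mul_add, vertex_two_mul, vertex_two_mul, Nat.cast_add, ZMod.natCast_self, add_zero]
  · rw [add_right_comm, ← mul_add, vertex_two_mul_add_one, vertex_two_mul_add_one, Nat.cast_add,
      ZMod.natCast_self, add_zero]

theorem vertex_ne_vertex_add_two (A : OrdinaryPolygon I n) (hn : 1 < n) (k : ℕ) :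
    A.vertex k ≠ A.vertex (k + 2) := by
  have : Fact (1 < n) := ⟨hn⟩
  obtain ⟨j, rfl | rfl⟩ := k.even_or_odd'
  · rw [show 2 * j + 2 = 2 * (j + 1) by ring, vertex_two_mul, vertex_two_mul, Nat.cast_succ]
    simp [A.pt_injective.eq_iff]
  · rw [show 2 * j + 1 + 2 = 2 * (j + 1) + 1 by ring, vertex_two_mul_add_one,
      vertex_two_mul_add_one, Nat.cast_succ]
    simp [A.ln_injective.eq_iff]

theorem exists_vertex_eq [NeZero n] (A : OrdinaryPolygon I n) {x : P ⊕ L} (hx : x ∈ A.elements) :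
    ∃ k < 2 * n, A.vertex k = x := by
  obtain ⟨i, rfl⟩ | ⟨i, rfl⟩ := hx <;> have hi := i.val_lt
  · exact ⟨2 * i.val, by omega, by rw [vertex_two_mul, ZMod.natCast_zmod_val]⟩
  · exact ⟨2 * i.val + 1, by omega, by rw [vertex_two_mul_add_one, ZMod.natCast_zmod_val]⟩

theorem exists_walk_vertex (A : OrdinaryPolygon I n) (k d : ℕ) :
    ∃ w : (incidenceGraph I).Walk (A.vertex k) (A.vertex (k + d)), w.length = d := by
  induction d with
  | zero => exact ⟨.nil, rfl⟩
  | succ d ih =>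
    obtain ⟨w, hw⟩ := ih
    exact ⟨w.concat (A.adj_vertex_succ (k + d)), by rw [SimpleGraph.Walk.length_concat, hw]⟩

theorem exists_walk_length_le [NeZero n] (A : OrdinaryPolygon I n) {x y : P ⊕ L}
    (hx : x ∈ A.elements) (hy : y ∈ A.elements) :
    ∃ w : (incidenceGraph I).Walk x y, w.length ≤ n := by
  obtain ⟨j, hj, rfl⟩ := A.exists_vertex_eq hx
  obtain ⟨k, hk, rfl⟩ := A.exists_vertex_eq hy
  wlog hjk : j ≤ k generalizing j k
  · obtain ⟨w, hw⟩ := this k hk hy j hj hx (le_of_not_ge hjk)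
    exact ⟨w.reverse, by rwa [SimpleGraph.Walk.length_reverse]⟩
  obtain ⟨d, rfl⟩ := Nat.exists_eq_add_of_le hjk
  obtain hd | hd := le_total d n
  · exact (A.exists_walk_vertex j d).imp fun w hw => hw.trans_le hd
  · have hback := A.exists_walk_vertex (j + d) (2 * n - d)
    rw [show j + d + (2 * n - d) = j + 2 * n by omega, vertex_add_two_mul] at hback
    obtain ⟨w, hw⟩ := hback
    exact ⟨w.reverse, by rw [SimpleGraph.Walk.length_reverse, hw]; omega⟩

theorem exists_adj_ne (A : OrdinaryPolygon I n) (hn : 1 < n) {x : P ⊕ L} (hx : x ∈ A.elements)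
    (u : P ⊕ L) : ∃ v, (incidenceGraph I).Adj x v ∧ v ≠ u := by
  have : NeZero n := ⟨by omega⟩
  obtain ⟨k, -, rfl⟩ := A.exists_vertex_eq hx
  have hpred : (incidenceGraph I).Adj (A.vertex k) (A.vertex (k + (2 * n - 1))) := by
    rw [← A.vertex_add_two_mul k, show k + 2 * n = k + (2 * n - 1) + 1 by omega]
    exact (A.adj_vertex_succ _).symm
  have hne : A.vertex (k + (2 * n - 1)) ≠ A.vertex (k + 1) := by
    rw [← A.vertex_add_two_mul (k + 1), show k + 1 + 2 * n = k + (2 * n - 1) + 2 by omega]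
    exact A.vertex_ne_vertex_add_two hn _
  by_cases hu : A.vertex (k + 1) = u
  · exact ⟨_, hpred, hu ▸ hne⟩
  · exact ⟨_, A.adj_vertex_succ k, hu⟩

theorem nonempty_of_isCycle {p : P} {w : (incidenceGraph I).Walk (Sum.inl p) (Sum.inl p)}
    (hw : w.IsCycle) (hn : w.length = 2 * n) : Nonempty (OrdinaryPolygon I n) := by
  have hlen := hw.three_le_length
  have : NeZero n := ⟨by omega⟩
  have hval : ∀ i : ZMod n, 2 * i.val < 2 * n ∧ 2 * i.val + 1 < 2 * n := fun i => by
    have hi := i.val_lt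
    omega
  have hparity : ∀ k < 2 * n, (Even k ↔ (w.getVert k).isLeft) := fun k hk => by
    have htake := even_length_iff_isLeft_eq (w.take k)
    rwa [SimpleGraph.Walk.take_length, hn, min_eq_left hk.le, Sum.isLeft_inl, eq_comm] at htake
  have hinj : ∀ j < 2 * n, ∀ k < 2 * n, w.getVert j = w.getVert k → j = k :=
    fun j hj k hk hjk => hw.getVert_injOn' (Nat.le_sub_one_of_lt (hn ▸ hj))
      (Nat.le_sub_one_of_lt (hn ▸ hk)) hjk
  have hpt : ∀ i : ZMod n, ∃ q, w.getVert (2 * i.val) = Sum.inl q := fun i =>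
    Sum.isLeft_iff.1 ((hparity _ (hval i).1).1 (even_two_mul _))
  have hln : ∀ i : ZMod n, ∃ l, w.getVert (2 * i.val + 1) = Sum.inr l := fun i =>
    Sum.isRight_iff.1 (Sum.not_isLeft.1 (mt (hparity _ (hval i).2).2 (by simp)))
  choose pt hpt using hpt
  choose ln hln using hln
  have hsucc : ∀ i : ZMod n, w.getVert (2 * i.val + 1 + 1) = Sum.inl (pt (i + 1)) := fun i => by
    have : Fact (1 < n) := ⟨by omega⟩
    rw [← hpt, ZMod.val_add, ZMod.val_one]
    obtain hlt | heq := (Nat.succ_le_of_lt i.val_lt).lt_or_eq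
    · rw [Nat.mod_eq_of_lt hlt]; rfl
    · rw [show i.val + 1 = n from heq, Nat.mod_self, mul_zero, SimpleGraph.Walk.getVert_zero,
        show 2 * i.val + 1 + 1 = w.length by omega, SimpleGraph.Walk.getVert_length]
  refine ⟨pt, ln, fun i j hij => ?_, fun i j hij => ?_, fun i => ?_, fun i => ?_⟩
  · have hij := hinj _ (hval i).1 _ (hval j).1 ((hpt i).trans (hij ▸ (hpt j).symm))
    exact ZMod.val_injective n (by omega)
  · have hij := hinj _ (hval i).2 _ (hval j).2 ((hln i).trans (hij ▸ (hln j).symm))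
    exact ZMod.val_injective n (by omega)
  · have hadj := w.adj_getVert_succ (hn ▸ (hval i).1)
    rwa [hpt, hln] at hadj
  · have hadj := w.adj_getVert_succ (hn ▸ (hval i).2)
    rwa [hsucc, hln] at hadj

end OrdinaryPolygon

theorem exists_isCycle_inl {x : P ⊕ L} {w : (incidenceGraph I).Walk x x} (hw : w.IsCycle) :
    ∃ (p : P) (w' : (incidenceGraph I).Walk (Sum.inl p) (Sum.inl p)),
      w'.IsCycle ∧ w'.length = w.length := by
  classical
  obtain p | l := x
  · exact ⟨p, w, hw, rfl⟩
  have hadj := w.adj_snd hw.not_nil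
  have hsnd := w.getVert_mem_support 1
  change w.snd ∈ w.support at hsnd
  generalize w.snd = y at *
  obtain p | m := y
  · exact ⟨p, w.rotate _ hsnd, by simpa using hw, by simp⟩
  · exact hadj.elim

section Metric

variable {x y z u v m m' : P ⊕ L}

theorem eltDist_comm (x y : P ⊕ L) : eltDist I x y = eltDist I y x :=
  SimpleGraph.dist_comm

theorem eltDist_eq_one_iff_adj : eltDist I x y = 1 ↔ (incidenceGraph I).Adj x y :=
  SimpleGraph.dist_eq_one_iff_adj

namespace IsGeneralisedHexagon

variable (h : IsGeneralisedHexagon I)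

include h

theorem connected : (incidenceGraph I).Connected :=
  { preconnected := fun x y => by
      obtain ⟨A, hx, hy⟩ := h.exists_hexagon x y
      exact (A.exists_walk_length_le hx hy).nonempty
    nonempty := h.nonempty }

theorem eltDist_eq_zero_iff : eltDist I x y = 0 ↔ x = y :=
  h.connected.dist_eq_zero_iff

theorem eltDist_le_six (x y : P ⊕ L) : eltDist I x y ≤ 6 := by
  obtain ⟨A, hx, hy⟩ := h.exists_hexagon x y
  obtain ⟨w, hw⟩ := A.exists_walk_length_le hx hy
  exact (SimpleGraph.dist_le w).trans hw

theorem twelve_le_egirth : 12 ≤ (incidenceGraph I).egirth := by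
  refine SimpleGraph.le_egirth.2 fun x w hw => ?_
  obtain ⟨p, w', hw', hlen⟩ := exists_isCycle_inl hw
  obtain ⟨n, hn⟩ := ((even_length_iff_isLeft_eq w').2 rfl).two_dvd
  have hthree := hw'.three_le_length
  have hn_large : 5 < n := by
    by_contra! hle
    have := OrdinaryPolygon.nonempty_of_isCycle hw' hn
    exact not_isEmpty_of_nonempty _ (h.no_small_polygon n (by omega) hle)
  exact_mod_cast (show 12 ≤ w.length by omega)

theorem exists_eltDist_eq_one_ne (x u : P ⊕ L) : ∃ v, eltDist I x v = 1 ∧ v ≠ u := by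
  obtain ⟨A, hx, -⟩ := h.exists_hexagon x x
  simpa only [eltDist_eq_one_iff_adj] using A.exists_adj_ne (by norm_num) hx u

theorem even_eltDist_iff (x y : P ⊕ L) : Even (eltDist I x y) ↔ x.isLeft = y.isLeft := by
  obtain ⟨w, hw⟩ := h.connected.exists_walk_length_eq_dist x y
  exact (congrArg Even hw).symm.to_iff.trans (even_length_iff_isLeft_eq w)

-- Bundled with the parity: one instance hands `omega` all constraints on the three distances.
theorem eltDist_triangle (x y z : P ⊕ L) :
    eltDist I x y ≤ eltDist I x z + eltDist I y z ∧
      eltDist I x z ≤ eltDist I x y + eltDist I y z ∧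
      eltDist I y z ≤ eltDist I x y + eltDist I x z ∧
      2 ∣ eltDist I x y + eltDist I x z + eltDist I y z := by
  have htriangle : ∀ a b c, eltDist I a c ≤ eltDist I a b + eltDist I b c := fun _ _ _ =>
    h.connected.dist_triangle
  refine ⟨eltDist_comm z y ▸ htriangle x z y, htriangle x y z, eltDist_comm y x ▸ htriangle y x z,
    ?_⟩
  rw [← even_iff_two_dvd, Nat.even_add, Nat.even_add, h.even_eltDist_iff, h.even_eltDist_iff,
    h.even_eltDist_iff]
  cases x.isLeft <;> cases y.isLeft <;> cases z.isLeft <;> decide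

theorem exists_between (j k : ℕ) (hxy : eltDist I x y = j + k) :
    ∃ m, eltDist I x m = j ∧ eltDist I y m = k :=
  exists_dist_eq_of_dist_eq_add h.connected hxy

theorem eq_of_between {j k : ℕ} (hxm : eltDist I x m = j) (hym : eltDist I y m = k)
    (hxm' : eltDist I x m' = j) (hym' : eltDist I y m' = k) (hxy : eltDist I x y = j + k)
    (hlt : j + k < 6) : m = m' :=
  eq_of_dist_eq_of_two_mul_lt_egirth h.connected hxm hym hxm' hym' hxy <|
    lt_of_lt_of_le (by exact_mod_cast (show 2 * (j + k) < 12 by omega)) h.twelve_le_egirth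

theorem eltDist_eq_add_two {k : ℕ} (hxy : eltDist I x y = k + 1) (hk : k + 1 < 6)
    (hxu : eltDist I x u = k) (hyu : eltDist I y u = 1) (hyv : eltDist I y v = 1) (huv : u ≠ v) :
    eltDist I x v = k + 2 := by
  have hxyv := h.eltDist_triangle x y v
  have hxv : eltDist I x v ≠ k := fun hxv => huv (h.eq_of_between hxu hyu hxv hyv hxy hk)
  omega

theorem eltDist_eq_five_of_eltDist_eq_six {w : P ⊕ L} (hxw : eltDist I x w = 6)
    (hwv : eltDist I w v = 1) : eltDist I x v = 5 := by
  have hxwv := h.eltDist_triangle x w v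
  have hle := h.eltDist_le_six x v
  omega

theorem eltDist_le_two_of_eltDist_eq_four {c w k : P ⊕ L} (hwk : eltDist I w k = 2)
    (hwc : eltDist I w c = 4) (hkc : eltDist I k c = 2) (hwz : eltDist I w z = 4)
    (hcz : eltDist I c z = 2) : eltDist I k z ≤ 2 := by
  obtain ⟨M, hcM, hzM⟩ := h.exists_between 1 1 hcz
  have hwM : eltDist I w M = 3 := by
    have hwcM := h.eltDist_triangle w c M
    by_contra hne
    obtain rfl : c = z := h.eq_of_between hwc (by rwa [eltDist_comm]) hwz (by rwa [eltDist_comm])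
      (show eltDist I w M = 4 + 1 by omega) (by norm_num)
    exact absurd (h.eltDist_eq_zero_iff.2 rfl) (hcz.trans_ne two_ne_zero)
  obtain ⟨b, hwb, hMb⟩ := h.exists_between 2 1 hwM
  have hcb : eltDist I c b = 2 := by
    have hcMb := h.eltDist_triangle c M b
    have hwcb := h.eltDist_triangle w c b
    omega
  obtain rfl : k = b := h.eq_of_between hwk (by rwa [eltDist_comm]) hwb hcb hwc (by norm_num)
  have hzMk := h.eltDist_triangle z M k
  rw [eltDist_comm]
  omega

theorem trace_two_ne_of_trace_two_eq {w k : P ⊕ L} (hxy : eltDist I x y = 6)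
    (hxw : eltDist I x w = 6) (hyw : eltDist I y w = 6) (hxk : eltDist I x k = 6)
    (hyk : eltDist I y k = 4) (hwk : eltDist I w k = 2) (htrace : trace I 2 x k = trace I 2 x y) :
    trace I 2 y x ≠ trace I 2 y w := by
  intro htrace'
  obtain ⟨W, hwW, hkW⟩ := h.exists_between 1 1 hwk
  have hyW := h.eltDist_eq_five_of_eltDist_eq_six hyw hwW
  obtain ⟨k₀, hxk₀, hWk₀⟩ := h.exists_between 4 1 (h.eltDist_eq_five_of_eltDist_eq_six hxw hwW)
  obtain ⟨c, hxc, hk₀c⟩ := h.exists_between 2 2 hxk₀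
  have hkk₀ := h.eltDist_triangle k W k₀
  have hwk₀ := h.eltDist_triangle w W k₀
  have hkc : eltDist I k c = 4 := by
    have hxkc := h.eltDist_triangle x k c
    have hkk₀c := h.eltDist_triangle k k₀ c
    omega
  have hyc : eltDist I y c = 4 := (htrace.le ⟨hxc, hkc⟩).2
  obtain ⟨z, hyz, hcz⟩ := h.exists_between 2 2 hyc
  have hxz : eltDist I x z = 4 := by
    have hxyz := h.eltDist_triangle x y z
    have hxcz := h.eltDist_triangle x c z
    omega
  have hwz : eltDist I w z = 4 := (htrace'.le ⟨hyz, hxz⟩).2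
  have hwc : eltDist I w c = 4 ∧ eltDist I w k₀ = 2 := by
    have hxwc := h.eltDist_triangle x w c
    have hwk₀c := h.eltDist_triangle w k₀ c
    omega
  have hk₀z := h.eltDist_le_two_of_eltDist_eq_four hwc.2 hwc.1 hk₀c hwz hcz
  have hyk₀ : eltDist I y k₀ = 4 := by
    have hyk₀z := h.eltDist_triangle y k₀ z
    have hyWk₀ := h.eltDist_triangle y W k₀
    omega
  -- `d(y, W) = 5`, so `W` carries a single element at distance `4` from `y`.
  obtain rfl : k = k₀ := h.eq_of_between hyk (by rwa [eltDist_comm]) hyk₀ hWk₀ hyW (by norm_num)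
  omega

theorem exists_mem_trace_two_eltDist_eq_six (hxy : eltDist I x y = 6) (hxz : eltDist I x z = 4) :
    ∃ p ∈ trace I 2 x y, eltDist I z p = 6 := by
  have hzx : eltDist I z x = 4 := eltDist_comm x z ▸ hxz
  obtain ⟨N, hxN, hzN⟩ := h.exists_between 1 3 hxz
  obtain ⟨N', hxN', hN'⟩ := h.exists_eltDist_eq_one_ne x N
  obtain ⟨p, hyp, hN'p⟩ := h.exists_between 4 1
    (h.eltDist_eq_five_of_eltDist_eq_six (eltDist_comm x y ▸ hxy) hxN')
  have hxp : eltDist I x p = 2 := by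
    have hxyp := h.eltDist_triangle x y p
    have hxN'p := h.eltDist_triangle x N' p
    omega
  have hxp_ne : x ≠ p := mt h.eltDist_eq_zero_iff.2 (by omega)
  have hzN' := h.eltDist_eq_add_two hzx (by norm_num) hzN hxN hxN' hN'.symm
  exact ⟨p, ⟨hxp, hyp⟩, h.eltDist_eq_add_two hzN' (by norm_num) hzx (eltDist_comm x N' ▸ hxN')
    hN'p hxp_ne⟩

theorem exists_trace_two_eq {p K : P ⊕ L} (hx : IsDistanceRegular I 2 x)
    (hxy : eltDist I x y = 6) (hxp : eltDist I x p = 2) (hyp : eltDist I y p = 4)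
    (hxK : eltDist I x K = 5) (hpK : eltDist I p K = 3) :
    ∃ k, eltDist I K k = 1 ∧ eltDist I x k = 6 ∧ trace I 2 x k = trace I 2 x y := by
  obtain ⟨z, hpz, hKz⟩ := h.exists_between 2 1 hpK
  have hxz : eltDist I x z = 4 := by
    have hxpz := h.eltDist_triangle x p z
    have hxKz := h.eltDist_triangle x K z
    omega
  obtain ⟨p', ⟨hxp', hyp'⟩, hzp'⟩ := h.exists_mem_trace_two_eltDist_eq_six hxy hxz
  obtain ⟨k, hp'k, hKk⟩ := h.exists_between 4 1
    (h.eltDist_eq_five_of_eltDist_eq_six (eltDist_comm z p' ▸ hzp') (eltDist_comm K z ▸ hKz))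
  have hzk : z ≠ k := by rintro rfl; rw [eltDist_comm] at hp'k; omega
  have hxk : eltDist I x k = 6 := h.eltDist_eq_add_two hxK (by norm_num) hxz hKz hKk hzk
  have hpk : eltDist I p k = 4 := by
    have hpKk := h.eltDist_triangle p K k
    have hxpk := h.eltDist_triangle x p k
    omega
  refine ⟨k, hKk, hxk, by_contra fun hne => ?_⟩
  obtain rfl : p = p' := hx k y hxk hxy hne ⟨⟨hxp, eltDist_comm p k ▸ hpk⟩, hxp, hyp⟩
    ⟨⟨hxp', eltDist_comm p' k ▸ hp'k⟩, hxp', hyp'⟩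
  rw [eltDist_comm] at hzp'
  omega

end IsGeneralisedHexagon

end Metric

theorem exists_eltDist_eq_one_ne_ne {p : P} (hp : 3 ≤ {l | I p l}.encard) (a b : P ⊕ L) :
    ∃ v, eltDist I (Sum.inl p) v = 1 ∧ v ≠ a ∧ v ≠ b := by
  have hlt : ({a, b} : Set (P ⊕ L)).encard < ((Sum.inr : L → P ⊕ L) '' {l | I p l}).encard := by
    have hpair := Set.encard_insert_le {b} a
    rw [Set.encard_singleton, one_add_one_eq_two] at hpair
    rw [Sum.inr_injective.encard_image]
    exact hpair.trans_lt (lt_of_lt_of_le (by norm_num) hp)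
  obtain ⟨_, ⟨l, hl, rfl⟩, hne⟩ := Set.not_subset.1 fun hs => hlt.not_ge (Set.encard_le_encard hs)
  exact ⟨Sum.inr l, eltDist_eq_one_iff_adj.2 hl, not_or.1 hne⟩

theorem IsGeneralisedHexagon.exists_trace_two_eq_of_thick (h : IsGeneralisedHexagon I)
    {x y : P ⊕ L} {z : P} (hx : IsDistanceRegular I 2 x) (hz : 3 ≤ {l | I z l}.encard)
    (hxy : eltDist I x y = 6) (hxz : eltDist I x (Sum.inl z) = 4)
    (hyz : eltDist I y (Sum.inl z) = 2) :
    ∃ k, eltDist I (Sum.inl z) k = 2 ∧ eltDist I x k = 6 ∧ eltDist I y k = 4 ∧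
      trace I 2 x k = trace I 2 x y := by
  obtain ⟨Y, hyY, hzY⟩ := h.exists_between 1 1 hyz
  obtain ⟨p, hxp, hzp⟩ := h.exists_between 2 2 hxz
  obtain ⟨M, hzM, hpM⟩ := h.exists_between 1 1 hzp
  obtain ⟨K, hzK, hKY, hKM⟩ := exists_eltDist_eq_one_ne_ne hz Y M
  have hKz : eltDist I K (Sum.inl z) = 1 := eltDist_comm K (Sum.inl z) ▸ hzK
  have hyp : eltDist I y p = 4 := by
    have hxyp := h.eltDist_triangle x y p
    have hyzp := h.eltDist_triangle y (Sum.inl z) p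
    omega
  have hxM : eltDist I x M = 3 := by
    have hxzM := h.eltDist_triangle x (Sum.inl z) M
    have hxpM := h.eltDist_triangle x p M
    omega
  have hxK := h.eltDist_eq_add_two hxz (by norm_num) hxM hzM hzK hKM.symm
  have hyK := h.eltDist_eq_add_two hyz (by norm_num) hyY hzY hzK hKY.symm
  have hpK : eltDist I p K = 3 := by
    have hzpK := h.eltDist_triangle (Sum.inl z) p K
    have hxpK := h.eltDist_triangle x p K
    omega
  obtain ⟨k, hKk, hxk, htrace⟩ := h.exists_trace_two_eq hx hxy hxp hyp hxK hpK
  have hzk : Sum.inl z ≠ k := by rintro rfl; omega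
  refine ⟨k, ?_, hxk, h.eltDist_eq_add_two hyK (by norm_num) hyz hKz hKk hzk, htrace⟩
  exact h.eltDist_eq_add_two hzK (by norm_num) (h.eltDist_eq_zero_iff.2 rfl) hKz hKk hzk

namespace IsOvoid

variable {O : Set P}

theorem exists_eq_or_eltDist_eq_two (hO : IsOvoid I O) (h : IsGeneralisedHexagon I) (z : P) :
    ∃ y ∈ O, y = z ∨ eltDist I (Sum.inl y) (Sum.inl z) = 2 := by
  obtain ⟨y, hy, hzy⟩ := hO.cover (Sum.inl z)
  obtain ⟨k, hk⟩ := (h.even_eltDist_iff (Sum.inl y) (Sum.inl z)).2 rfl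
  rw [eltDist_comm] at hzy
  refine ⟨y, hy, or_iff_not_imp_left.2 fun hne => ?_⟩
  have hpos := mt h.eltDist_eq_zero_iff.1 (Sum.inl_injective.ne hne)
  omega

theorem exists_eltDist_eq_two (hO : IsOvoid I O) (h : IsGeneralisedHexagon I) {y : P}
    (hy : y ∈ O) {p : P ⊕ L} (hyp : eltDist I (Sum.inl y) p = 4) :
    ∃ x ∈ O, eltDist I (Sum.inl x) (Sum.inl y) = 6 ∧ eltDist I (Sum.inl x) p = 2 := by
  obtain ⟨x, hx, hpx⟩ := hO.cover p
  rw [eltDist_comm] at hpx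
  have hxy : eltDist I (Sum.inl x) (Sum.inl y) = 6 :=
    hO.opposite x hx y hy (by rintro rfl; omega)
  have hxyp := h.eltDist_triangle (Sum.inl x) (Sum.inl y) p
  exact ⟨x, hx, hxy, by omega⟩

theorem exists_trace_inter_trace_eq (hO : IsOvoid I O) (h : IsGeneralisedHexagon I)
    (hreg : ∀ p ∈ O, IsDistanceRegular I 2 (Sum.inl p)) {y z : P} (hy : y ∈ O)
    (hz : 3 ≤ {l | I z l}.encard) (hyz : eltDist I (Sum.inl y) (Sum.inl z) = 2) :
    ∃ x ∈ O, ∃ w ∈ O, trace I 2 (Sum.inl y) (Sum.inl x) ∩ trace I 2 (Sum.inl y) (Sum.inl w) =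
      {Sum.inl z} := by
  obtain ⟨Y, hyY, hzY⟩ := h.exists_between 1 1 hyz
  obtain ⟨M, hzM, hMY⟩ := h.exists_eltDist_eq_one_ne (Sum.inl z) Y
  obtain ⟨p, hMp, hpz⟩ := h.exists_eltDist_eq_one_ne M (Sum.inl z)
  have hyM := h.eltDist_eq_add_two hyz (by norm_num) hyY hzY hzM hMY.symm
  rw [eltDist_comm] at hzM
  have hyp := h.eltDist_eq_add_two hyM (by norm_num) hyz hzM hMp hpz.symm
  obtain ⟨x, hx, hxy, hxp⟩ := hO.exists_eltDist_eq_two h hy hyp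
  have hxz : eltDist I (Sum.inl x) (Sum.inl z) = 4 := by
    have hMzp := h.eltDist_triangle M (Sum.inl z) p
    have hxyz := h.eltDist_triangle (Sum.inl x) (Sum.inl y) (Sum.inl z)
    have hxzp := h.eltDist_triangle (Sum.inl x) (Sum.inl z) p
    omega
  obtain ⟨k, hzk, hxk, hyk, htrace⟩ := h.exists_trace_two_eq_of_thick (hreg x hx) hz hxy hxz hyz
  obtain ⟨w, hw, hwy, hwk⟩ := hO.exists_eltDist_eq_two h hy hyk
  have hxw : eltDist I (Sum.inl x) (Sum.inl w) = 6 := hO.opposite x hx w hw (by rintro rfl; omega)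
  have hwz : eltDist I (Sum.inl w) (Sum.inl z) = 4 := by
    have hwyz := h.eltDist_triangle (Sum.inl w) (Sum.inl y) (Sum.inl z)
    have hwzk := h.eltDist_triangle (Sum.inl w) (Sum.inl z) k
    omega
  have hyx := (eltDist_comm _ _).trans hxy
  have hyw := (eltDist_comm _ _).trans hwy
  have hne := h.trace_two_ne_of_trace_two_eq hxy hxw hyw hxk hyk hwk htrace
  refine ⟨x, hx, w, hw, ?_⟩
  exact (hreg y hy _ _ hyx hyw hne).eq_singleton_of_mem ⟨⟨hyz, hxz⟩, hyz, hwz⟩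

end IsOvoid

namespace Collineation

/-- The automorphism of the incidence graph induced by a collineation. -/
def graphIso (θ : Collineation I) : incidenceGraph I ≃g incidenceGraph I where
  toEquiv := Equiv.sumCongr θ.onPoints θ.onLines
  map_rel_iff' := by
    rintro (p | l) (q | m)
    exacts [Iff.rfl, θ.map_inc p m, θ.map_inc q l, Iff.rfl]

theorem eltDist_onElements (θ : Collineation I) (x y : P ⊕ L) :
    eltDist I (θ.onElements x) (θ.onElements y) = eltDist I x y :=
  dist_iso θ.graphIso x y

theorem onElements_mem_trace (θ : Collineation I) {i : ℕ} {x y z : P ⊕ L}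
    (hx : θ.onElements x = x) (hy : θ.onElements y = y) (hz : z ∈ trace I i x y) :
    θ.onElements z ∈ trace I i x y := by
  rw [← hx, ← hy]
  exact ⟨(θ.eltDist_onElements x z).trans hz.1, (θ.eltDist_onElements y z).trans hz.2⟩

theorem eq_refl_of_onPoints_eq (h : IsGeneralisedHexagon I) {θ : Collineation I}
    (hθ : ∀ p, θ.onPoints p = p) : θ = Collineation.refl I := by
  refine Collineation.ext (Equiv.ext hθ) (Equiv.ext fun l => Sum.inr_injective (α := P) ?_)
  have hfix : ∀ e, eltDist I (Sum.inr l) e = 1 → eltDist I (Sum.inr (θ.onLines l)) e = 1 := by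
    rintro (p | m) he
    · rwa [← θ.eltDist_onElements, onElements, Sum.map_inl, hθ] at he
    · exact (eltDist_eq_one_iff_adj.1 he).elim
  obtain ⟨a, ha, -⟩ := h.exists_eltDist_eq_one_ne (Sum.inr l) (Sum.inr l)
  obtain ⟨b, hb, hba⟩ := h.exists_eltDist_eq_one_ne (Sum.inr l) a
  have hab : eltDist I a b = 1 + 1 := by
    have hlab := h.eltDist_triangle (Sum.inr l) a b
    have hpos := mt h.eltDist_eq_zero_iff.1 hba.symm
    omega
  simp only [eltDist_comm (Sum.inr _)] at ha hb hfix
  exact h.eq_of_between (hfix a ha) (hfix b hb) ha hb hab (by norm_num)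

end Collineation

end MoufangHexagon

theorem mainTheorem9_general {P L : Type*} {I : P → L → Prop}
    (hI : MoufangHexagon.IsGeneralisedHexagon I) (hthick : ∀ p : P, 3 ≤ {l | I p l}.encard)
    {O : Set P} (hO : MoufangHexagon.IsOvoid I O)
    (hreg : ∀ p ∈ O, MoufangHexagon.IsDistanceRegular I 2 (Sum.inl p))
    {θ : MoufangHexagon.Collineation I} (hθ : θ.Fixes O) :
    θ = MoufangHexagon.Collineation.refl I := by
  refine MoufangHexagon.Collineation.eq_refl_of_onPoints_eq hI fun z => ?_
  have hfix : ∀ q ∈ O, θ.onElements (Sum.inl q) = Sum.inl q := fun q hq =>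
    congrArg Sum.inl (hθ q hq)
  obtain ⟨y, hy, rfl | hyz⟩ := hO.exists_eq_or_eltDist_eq_two hI z
  · exact hθ y hy
  obtain ⟨x, hx, w, hw, htrace⟩ := hO.exists_trace_inter_trace_eq hI hreg hy (hthick z) hyz
  obtain ⟨hzx, hzw⟩ := htrace.ge rfl
  exact Sum.inl_injective <| htrace.le ⟨θ.onElements_mem_trace (hfix y hy) (hfix x hx) hzx,
    θ.onElements_mem_trace (hfix y hy) (hfix w hw) hzw⟩

theorem mainTheorem9 {P : Type*} {L : Type*} (I : P → L → Prop)
    (hM : MoufangHexagon.IsMoufangHexagon I) (hreg : MoufangHexagon.IsPointRegular I) :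
    ¬ ∃ θ : MoufangHexagon.Collineation I,
      θ ≠ MoufangHexagon.Collineation.refl I ∧
        ∃ O : Set P, MoufangHexagon.IsOvoid I O ∧ θ.Fixes O := by
  rintro ⟨θ, hne, O, hO, hθ⟩
  exact hne <|
    mainTheorem9_general hM.isGeneralisedHexagon hM.isThick.2 hO (fun p _ => (hreg p).1) hθ
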